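/- Let $T$ be a first-order theory in a language $L$. A formula $\phi(x,y)$, with $x,y$ finite tuples of variables, is NIP (with respect to $T$) if in no model of $T$ there are tuples $(a_t)_{t\in\mathbb{N}}$ and $(b_s)_{s\subseteq\mathbb{N}}$ such that $\phi(a_t,b_s)$ holds if and only if $t\in s$; the theory $T$ is NIP if every such formula is NIP. For a model $M$ of $T$ and $n,m\in\mathbb{N}\cup\{\infty\}$, say that $M$ is $(n,m)$-stably embedded if for every elementary extension $N\succeq M$, every $L$-formula $\phi(x,y)$ with $x$ a tuple of finite length at most $n$ and $y$ a tuple of finite length at most $m$, and every tuple $a$ from $N$ of the length of $y$, there are an $L$-formula $\psi(x,z)$ and a finite tuple $b$ from $M$ such that $\phi(M,a)=\psi(M,b)$, where $\phi(M,a)$ denotes the set of tuples $c$ from $M$ such that $N\models\phi(c,a)$ (similarly for $\psi(M,b)$). Proposition. Let $T$ be NIP, let $M$ be a (nonempty) model of $T$, and let $n\in\mathbb{N}$. If $M$ is $(\infty,n)$-stably embedded, then $M$ is $(n,\infty)$-stably embedded. -/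

import Mathlib

universe u v w

namespace FirstOrder.Language

/-- The formula `φ(x, y)`, with `x` a `k`-tuple and `y` an `l`-tuple of variables, is NIP with
respect to `T`: in no model of `T` are there tuples `a t` (`t ∈ ℕ`) and `b s` (`s ⊆ ℕ`) such that
`φ(a t, b s)` holds exactly when `t ∈ s`. (By compactness and Löwenheim-Skolem, such a configuration
exists in some model of `T` if and only if it exists in one in the universe `max u v`;
if `T` is complete, this means that it exists in a monster model of `T`.) -/
def Theory.IsNIPFormula {L : Language.{u, v}} (T : L.Theory) {k l : ℕ}
    (φ : L.Formula (Fin k ⊕ Fin l)) : Prop :=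
  ∀ N : Theory.ModelType.{u, v, max u v} T,
    ¬ ∃ (a : ℕ → Fin k → N) (b : Set ℕ → Fin l → N),
      ∀ (t : ℕ) (s : Set ℕ), φ.Realize (Sum.elim (a t) (b s)) ↔ t ∈ s

/-- A theory is NIP if all formulas `φ(x, y)`, with `x`, `y` finite tuples, are. -/
def Theory.IsNIP {L : Language.{u, v}} (T : L.Theory) : Prop :=
  ∀ (k l : ℕ) (φ : L.Formula (Fin k ⊕ Fin l)), T.IsNIPFormula φ

/-- A subset `A` of a structure `N` is `(n, m)`-stably embedded in `N`: every subset of `A ^ k`,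
`k ≤ n`, of the form `φ(A, a)` with `a` a tuple from `N` of (finite) length `l ≤ m` is of the form
`ψ(A, b)` with `b` a finite tuple from `A`. Here `n`, `m` may be infinite (`⊤`), in which case there
is no bound on `k`, resp. `l`. For finite `n`, adding dummy variables shows that the condition
for `k = n` implies the condition for all `k ≤ n`. -/
def IsStablyEmbeddedSet (L : Language.{u, v}) {N : Type w} [L.Structure N] (A : Set N)
    (n m : ℕ∞) : Prop :=
  ∀ k l : ℕ, (k : ℕ∞) ≤ n → (l : ℕ∞) ≤ m →
    ∀ (φ : L.Formula (Fin k ⊕ Fin l)) (a : Fin l → N),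
      ∃ (j : ℕ) (ψ : L.Formula (Fin k ⊕ Fin j)) (b : Fin j → N), (∀ i, b i ∈ A) ∧
        ∀ x : Fin k → N, (∀ i, x i ∈ A) →
          (φ.Realize (Sum.elim x a) ↔ ψ.Realize (Sum.elim x b))

/-- A structure `M` is `(n, m)`-stably embedded if it is so as a subset of each of its elementary
extensions. (Every type over `M` in finitely many variables is realized in an elementary extension
in the universe `max u v w`, so this is the same as being `(n, m)`-stably embedded in a monster
model having `M` as a small elementary substructure.) -/
def IsStablyEmbeddedModel (L : Language.{u, v}) (M : Type w) [L.Structure M]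
    (n m : ℕ∞) : Prop :=
  ∀ (N : Type (max u v w)) [L.Structure N] (f : M ↪ₑ[L] N),
    L.IsStablyEmbeddedSet (Set.range f) n m

end FirstOrder.Language

namespace FirstOrder.Language

open Filter Set

section Definability

variable {L : Language.{u, v}} {M : Type w} [L.Structure M]

/-! Suppose `X = φ(M, a)` is not definable. Then there are ultrafilters on `M ^ k` with the same
definable members, one containing `X` and the other its complement
(`exists_ultrafilter_pair_of_not_definable`). Iterated products of the two, in any pattern `ε`,
contain the same definable sets, because types in at most `n` variables are definable
(`IsStablyEmbeddedModel.eventually_mixedPower_of_definable`). In the product for `ε`, the tuple `a`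
witnesses that `φ` cuts out the pattern `ε`; by elementarity this is seen in `M`. So a single
product satisfies all patterns at once, and `φ` shatters arbitrarily large finite sets,
contradicting NIP. -/

/-- A set is definable with parameters exactly when it is defined by a formula together with a
finite tuple of parameters. -/
theorem definable_univ_iff_exists_tuple {α : Type*} {s : Set (α → M)} :
    (univ : Set M).Definable L s ↔ ∃ (j : ℕ) (ψ : L.Formula (α ⊕ Fin j)) (b : Fin j → M),
      s = {v | ψ.Realize (Sum.elim v b)} := by
  constructor
  · intro h
    obtain ⟨A, -, hA⟩ := definable_iff_finitely_definable.1 h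
    obtain ⟨φ, rfl⟩ := definable_iff_exists_formula_sum.1 hA
    refine ⟨A.card, φ.relabel (Sum.elim (Sum.inr ∘ A.equivFin) Sum.inl),
      fun i => A.equivFin.symm i, ?_⟩
    ext v
    simp only [mem_ofPred_eq, Formula.realize_relabel]
    refine iff_of_eq (congrArg _ (funext ?_))
    rintro (x | x) <;> simp
  · rintro ⟨j, ψ, b, rfl⟩
    refine definable_iff_exists_formula_sum.2
      ⟨ψ.relabel (Sum.elim Sum.inr fun i => Sum.inl ⟨b i, mem_univ _⟩), ?_⟩
    ext v
    simp only [mem_ofPred_eq, Formula.realize_relabel]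
    refine iff_of_eq (congrArg _ (funext ?_))
    rintro (x | x) <;> simp

theorem definable_fiber {α β : Type*} {s : Set (α ⊕ β → M)}
    (hs : (univ : Set M).Definable L s) (v : α → M) :
    (univ : Set M).Definable L {x : β → M | Sum.elim v x ∈ s} := by
  obtain ⟨φ, rfl⟩ := definable_iff_exists_formula_sum.1 hs
  refine definable_iff_exists_formula_sum.2
    ⟨φ.relabel (Sum.elim Sum.inl (Sum.elim (fun i => Sum.inl ⟨v i, mem_univ _⟩) Sum.inr)), ?_⟩
  ext x
  simp only [mem_ofPred_eq, Formula.realize_relabel]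
  refine iff_of_eq (congrArg _ (funext ?_))
  rintro (i | i | i) <;> simp

/-- Every ultrafilter on the `k`-tuples of `M` is generic for a `k`-tuple in some elementary
extension of `M`. -/
theorem exists_elementaryEmbedding_realizing_ultrafilter [Nonempty M] {k : ℕ}
    (U : Ultrafilter (Fin k → M)) :
    ∃ (N : Type (max u v w)) (_ : L.Structure N) (f : M ↪ₑ[L] N) (a : Fin k → N),
      ∀ {β : Type} (θ : L.Formula (β ⊕ Fin k)) (c : β → M),
        θ.Realize (Sum.elim (f ∘ c) a) ↔ ∀ᶠ x in U, θ.Realize (Sum.elim c x) := by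
  let P := (U : Filter (Fin k → M)).Product fun _ => M
  -- The lift moves the ultrapower into the universe over which `IsStablyEmbeddedModel` quantifies.
  let e : P ≃ ULift.{max u v} P := Equiv.ulift.symm
  let q : ((Fin k → M) → M) → P := fun g => (g : P)
  let _ : L.Structure (ULift.{max u v} P) := e.inducedStructure
  let e' : P ≃[L] ULift.{max u v} P := e.inducedStructureEquiv
  let d : M ↪ₑ[L] P :=
    { toFun := fun m => q fun _ => m
      map_formula' := fun {n} φ x => by
        refine (Ultraproduct.realize_formula_cast φ fun i _ => x i).trans ?_
        simp only [eventually_const] }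
  refine ⟨ULift.{max u v} P, inferInstance, e'.toElementaryEmbedding.comp d,
    fun i => e' (q fun x => x i), fun {β} θ c => ?_⟩
  have h1 := e'.toElementaryEmbedding.map_formula θ (Sum.elim (d ∘ c) fun i => q fun x => x i)
  have h2 := Ultraproduct.realize_formula_cast (u := U) (M := fun _ => M) θ
    (Sum.elim (fun i _ => c i) fun i x => x i)
  have h3 : (e'.toElementaryEmbedding ∘ Sum.elim (d ∘ c) fun i => q fun x => x i) =
      Sum.elim ((e'.toElementaryEmbedding.comp d) ∘ c) fun i => e' (q fun x => x i) := by
    funext i; rcases i with i | i <;> rfl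
  have h4 : (Sum.elim (d ∘ c) fun i => q fun x => x i) =
      fun i => q (Sum.elim (fun i _ => c i) (fun i x => x i) i) := by
    funext i; rcases i with i | i <;> rfl
  rw [← h3, h1, h4]
  refine h2.trans (eventually_congr (Eventually.of_forall fun x => ?_))
  refine iff_of_eq (congrArg _ (funext ?_))
  rintro (i | i) <;> rfl

/-- If all types over `M` in at most `n` variables are definable, then so is the eventual truth
along an ultrafilter of a definable relation. -/
theorem IsStablyEmbeddedModel.definable_eventually [Nonempty M] {n k : ℕ} (hk : k ≤ n)
    (h : L.IsStablyEmbeddedModel M ⊤ (n : ℕ∞)) (U : Ultrafilter (Fin k → M))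
    {α : Type} [Finite α] {s : Set (α ⊕ Fin k → M)} (hs : (univ : Set M).Definable L s) :
    (univ : Set M).Definable L {v : α → M | ∀ᶠ x in U, Sum.elim v x ∈ s} := by
  obtain ⟨j, ψ, b, rfl⟩ := definable_univ_iff_exists_tuple.1 hs
  obtain ⟨N, _, f, a, ha⟩ := exists_elementaryEmbedding_realizing_ultrafilter (L := L) U
  obtain ⟨r, ⟨e⟩⟩ := Finite.exists_equiv_fin (α ⊕ Fin j)
  -- The parameters `b` become extra variables on the left, where the arity is unbounded.
  let θ : L.Formula (Fin r ⊕ Fin k) :=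
    ψ.relabel (Sum.elim (Sum.elim (Sum.inl ∘ e ∘ Sum.inl) Sum.inr) (Sum.inl ∘ e ∘ Sum.inr))
  have hθ (v : α → M) (x : Fin k → M) :
      θ.Realize (Sum.elim (Sum.elim v b ∘ e.symm) x) ↔
        ψ.Realize (Sum.elim (Sum.elim v x) b) := by
    rw [Formula.realize_relabel]
    refine iff_of_eq (congrArg _ (funext ?_))
    rintro ((i | i) | i) <;> simp
  obtain ⟨j', χ, c, hc, hχ⟩ := h N f r k le_top (by exact_mod_cast hk) θ a
  choose c' hc' using hc
  obtain rfl : f ∘ c' = c := funext hc'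
  refine definable_univ_iff_exists_tuple.2 ⟨j + j',
    χ.relabel (Sum.elim (Sum.map id (Fin.castAdd j') ∘ e.symm) (Sum.inr ∘ Fin.natAdd j)),
    Fin.append b c', ?_⟩
  ext v
  simp only [mem_ofPred_eq, Formula.realize_relabel]
  have h1 := hχ (f ∘ (Sum.elim v b ∘ e.symm)) fun i => ⟨_, rfl⟩
  rw [ha, ← Sum.comp_elim, f.map_formula] at h1
  simp only [hθ] at h1
  rw [h1]
  refine iff_of_eq (congrArg _ (funext ?_))
  rintro (i | i)
  · rcases hi : e.symm i with y | y <;> simp [hi]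
  · simp

end Definability

section Ultrafilters

variable {L : Language.{u, v}} {M : Type w} [L.Structure M]

/-- A non-definable set and its complement belong to ultrafilters with the same definable
members. -/
theorem exists_ultrafilter_pair_of_not_definable {α : Type*} {X : Set (α → M)}
    (hX : ¬ (univ : Set M).Definable L X) :
    ∃ U : Bool → Ultrafilter (α → M), (∀ b, ∀ᶠ x in U b, x ∈ X ↔ b = true) ∧
      ∀ D, (univ : Set M).Definable L D → ∀ b b', D ∈ U b → D ∈ U b' := by
  -- The definable sets with definable trace on `X` are closed under union; `F` is generated by
  -- their complements, and is proper because `X` is not definable.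
  let F : Filter (α → M) :=
    { sets := {S | ∃ D, (univ : Set M).Definable L D ∧ (univ : Set M).Definable L (D ∩ X) ∧
        Dᶜ ⊆ S}
      univ_sets := ⟨∅, definable_empty, by simp, subset_univ _⟩
      sets_of_superset := fun ⟨D, h1, h2, h3⟩ h => ⟨D, h1, h2, h3.trans h⟩
      inter_sets := fun ⟨D, h1, h2, h3⟩ ⟨E, k1, k2, k3⟩ => ⟨D ∪ E, h1.union k1, by
        rw [union_inter_distrib_right]; exact h2.union k2, by
        rw [compl_union]; exact inter_subset_inter h3 k3⟩ }
  have hF : F.NeBot := by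
    refine ⟨fun h => hX ?_⟩
    obtain ⟨D, -, h2, h3⟩ : ∅ ∈ F := h ▸ mem_bot
    rw [subset_empty_iff, compl_empty_iff] at h3
    simpa [h3] using h2
  let V := Ultrafilter.of F
  have hV {D} (hD : (univ : Set M).Definable L D) (hDV : D ∈ V) :
      ¬ (univ : Set M).Definable L (D ∩ X) := fun h =>
    Ultrafilter.compl_mem_iff_notMem.1 (Ultrafilter.of_le F ⟨D, hD, h, Subset.rfl⟩) hDV
  -- `G` decides every definable set as `V` does, yet is compatible with `X` and with its
  -- complement: a definable `D ∈ V` inside one of them would have trace `∅` or `D` on `X`.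
  let G : Filter (α → M) :=
    { sets := {S | ∃ D, (univ : Set M).Definable L D ∧ D ∈ V ∧ D ⊆ S}
      univ_sets := ⟨univ, definable_univ, univ_mem, subset_univ _⟩
      sets_of_superset := fun ⟨D, h1, h2, h3⟩ h => ⟨D, h1, h2, h3.trans h⟩
      inter_sets := fun ⟨D, h1, h2, h3⟩ ⟨E, k1, k2, k3⟩ =>
        ⟨D ∩ E, h1.inter k1, inter_mem h2 k2, inter_subset_inter h3 k3⟩ }
  have hG (b : Bool) : (G ⊓ 𝓟 {x | x ∈ X ↔ b = true}).NeBot := by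
    rw [inf_principal_neBot_iff]
    rintro S ⟨D, h1, h2, h3⟩
    by_contra hne
    rw [not_nonempty_iff_eq_empty] at hne
    refine hV h1 h2 ?_
    cases b
    · have : D ∩ X = D := inter_eq_left.2 fun x hx => by
        by_contra hxX
        exact (hne ▸ (⟨h3 hx, by simpa using hxX⟩ : x ∈ S ∩ {x | x ∈ X ↔ false = true}) :
          x ∈ (∅ : Set (α → M)))
      rwa [this]
    · have : D ∩ X = ∅ := eq_empty_of_forall_notMem fun x hx =>
        (hne ▸ (⟨h3 hx.1, by simpa using hx.2⟩ : x ∈ S ∩ {x | x ∈ X ↔ true = true}) :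
          x ∈ (∅ : Set (α → M)))
      simp [this]
  have key (b : Bool) {D} (hD : (univ : Set M).Definable L D) :
      D ∈ @Ultrafilter.of _ _ (hG b) ↔ D ∈ V := by
    have hle := (@Ultrafilter.of_le _ _ (hG b)).trans inf_le_left
    refine ⟨fun h => ?_, fun h => hle ⟨D, hD, h, Subset.rfl⟩⟩
    by_contra h'
    exact Ultrafilter.compl_mem_iff_notMem.1
      (hle ⟨Dᶜ, hD.compl, Ultrafilter.compl_mem_iff_notMem.2 h', Subset.rfl⟩) h
  refine ⟨fun b => @Ultrafilter.of _ _ (hG b), fun b => ?_, fun D hD b b' h =>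
    (key b' hD).2 ((key b hD).1 h)⟩
  exact (@Ultrafilter.of_le _ _ (hG b)).trans inf_le_right (mem_principal_self _)

/-- The ultrafilter of tuples `(x 0, …, x (m - 1))` in which `x i` is generic for `U (ε i)` over
the later entries. -/
def mixedPower {X : Type*} (U : Bool → Ultrafilter X) :
    (m : ℕ) → (Fin m → Bool) → Ultrafilter (Fin m → X)
  | 0, _ => pure Fin.elim0
  | m + 1, ε => (mixedPower U m (Fin.tail ε)).bind fun l => (U (ε 0)).map fun x => Fin.cons x l

theorem eventually_mixedPower_succ {X : Type*} (U : Bool → Ultrafilter X) {m : ℕ}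
    (ε : Fin (m + 1) → Bool) (p : (Fin (m + 1) → X) → Prop) :
    (∀ᶠ l in mixedPower U (m + 1) ε, p l) ↔
      ∀ᶠ l in mixedPower U m (Fin.tail ε), ∀ᶠ x in U (ε 0), p (Fin.cons x l) :=
  Iff.rfl

theorem eventually_mixedPower_forall {X : Type*} (U : Bool → Ultrafilter X) (p : Bool → X → Prop)
    (hp : ∀ b, ∀ᶠ x in U b, p b x) (m : ℕ) (ε : Fin m → Bool) :
    ∀ᶠ l : Fin m → X in mixedPower U m ε, ∀ i, p (ε i) (l i) := by
  induction m with
  | zero => exact Eventually.of_forall fun _ i => Fin.elim0 i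
  | succ m ih =>
    rw [eventually_mixedPower_succ]
    filter_upwards [ih (Fin.tail ε)] with l hl
    filter_upwards [hp (ε 0)] with x hx
    exact Fin.forall_fin_succ.2 ⟨hx, hl⟩

/-- If types in at most `n` variables are definable, the mixed powers of ultrafilters inducing the
same type all induce the same type. -/
theorem IsStablyEmbeddedModel.eventually_mixedPower_of_definable [Nonempty M] {n k : ℕ}
    (hk : k ≤ n) (h : L.IsStablyEmbeddedModel M ⊤ (n : ℕ∞)) {U : Bool → Ultrafilter (Fin k → M)}
    (hU : ∀ D, (univ : Set M).Definable L D → ∀ b b', D ∈ U b → D ∈ U b') (m : ℕ)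
    {s : Set (Fin m × Fin k → M)} (hs : (univ : Set M).Definable L s) (ε ε' : Fin m → Bool)
    (hε : ∀ᶠ l in mixedPower U m ε, Function.uncurry l ∈ s) :
    ∀ᶠ l in mixedPower U m ε', Function.uncurry l ∈ s := by
  induction m with
  | zero => rwa [Subsingleton.elim ε' ε]
  | succ m ih =>
    rw [eventually_mixedPower_succ] at hε ⊢
    let g : Fin (m + 1) × Fin k → (Fin m × Fin k) ⊕ Fin k := fun p =>
      Fin.cases (Sum.inr p.2) (fun i => Sum.inl (i, p.2)) p.1
    have hg (l : Fin m → Fin k → M) (x : Fin k → M) :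
        Sum.elim (Function.uncurry l) x ∘ g =
          Function.uncurry (Fin.cons x l : Fin (m + 1) → Fin k → M) := by
      funext ⟨i, j⟩
      refine Fin.cases ?_ (fun i => ?_) i <;> rfl
    have hs' := hs.preimage_comp g
    -- Definability of the type of `U (ε 0)` turns the inner quantifier into a definable condition
    -- on `l`, to which induction applies; `hU` then replaces `U (ε 0)` by `U (ε' 0)` on each fibre.
    have h1 := ih (h.definable_eventually hk (U (ε 0)) hs') (Fin.tail ε) (Fin.tail ε') (by
      simpa only [mem_ofPred_eq, mem_preimage, hg] using hε)
    simp only [mem_ofPred_eq, mem_preimage, hg] at h1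
    filter_upwards [h1] with l hl
    have h2 := definable_fiber hs' (Function.uncurry l)
    simp only [mem_preimage, hg] at h2
    exact hU _ h2 _ _ hl

end Ultrafilters

variable {L : Language.{u, v}} {M : Type w} [L.Structure M]

/-- The formula or its negation, as prescribed by a truth value. -/
def signedFormula {α : Type*} (φ : L.Formula α) (b : Bool) : L.Formula α :=
  bif b then φ else φ.not

theorem realize_signedFormula {α : Type*} (φ : L.Formula α) (b : Bool) (v : α → M) :
    (signedFormula φ b).Realize v ↔ (φ.Realize v ↔ b = true) := by
  cases b <;> simp [signedFormula]

/-- The formula in the variables `x 0, …, x (m - 1)` saying that for some `y`, the truth values of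
`φ(x i, y)` are as prescribed. -/
noncomputable def patternFormula {k l m : ℕ} (φ : L.Formula (Fin k ⊕ Fin l)) (ε : Fin m → Bool) :
    L.Formula (Fin m × Fin k) :=
  Formula.iExs (Fin l) <| Formula.iInf fun i =>
    signedFormula (φ.relabel (Sum.map (fun j => (i, j)) id)) (ε i)

theorem realize_patternFormula {k l m : ℕ} (φ : L.Formula (Fin k ⊕ Fin l)) (ε : Fin m → Bool)
    (x : Fin m → Fin k → M) :
    (patternFormula φ ε).Realize (Function.uncurry x) ↔
      ∃ b : Fin l → M, ∀ i, φ.Realize (Sum.elim (x i) b) ↔ ε i = true := by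
  simp only [patternFormula, Formula.realize_iExs, Formula.realize_iInf, realize_signedFormula,
    Formula.realize_relabel, Sum.elim_comp_map]
  rfl

/-- By compactness, an NIP formula cannot shatter arbitrarily large finite sets in a model. -/
theorem Theory.IsNIPFormula.not_forall_exists_shattered {T : L.Theory} [Nonempty M] (hM : M ⊨ T)
    {k l : ℕ} {φ : L.Formula (Fin k ⊕ Fin l)} (hφ : T.IsNIPFormula φ) :
    ¬ ∀ m : ℕ, ∃ a : Fin m → Fin k → M, ∀ ε : Fin m → Bool, ∃ b : Fin l → M,
      ∀ i, φ.Realize (Sum.elim (a i) b) ↔ ε i = true := by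
  classical
  intro hsh
  let C := (ℕ × Fin k) ⊕ (Set ℕ × Fin l)
  let τ (t : ℕ) (s : Set ℕ) : L.Formula C :=
    signedFormula (φ.relabel (Sum.map (fun i => (t, i)) (fun i => (s, i)))) (decide (t ∈ s))
  let S (n : ℕ) : L[[C]].Theory := (L.lhomWithConstants C).onTheory T ∪
    {χ | ∃ t < n, ∃ s, χ = Formula.equivSentence (τ t s)}
  have hS : Directed (· ⊆ ·) S := Monotone.directed_le fun n m hnm =>
    union_subset_union_right _ fun χ ⟨t, ht, h⟩ => ⟨t, ht.trans_le hnm, h⟩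
  have hsat : Theory.IsSatisfiable (⋃ n, S n) := by
    rw [Theory.isSatisfiable_directed_union_iff hS]
    intro n
    obtain ⟨a, ha⟩ := hsh n
    choose b hb using ha
    -- The values at indices `≥ n` are arbitrary, as `S n` only mentions `t < n`.
    let c : C → M := Sum.elim
      (fun p => if h : p.1 < n then a ⟨p.1, h⟩ p.2 else Classical.arbitrary M)
      (fun p => b (fun i => decide ((i : ℕ) ∈ p.1)) p.2)
    let _ := constantsOn.structure c
    have : M ⊨ S n := by
      refine Theory.Model.union ((LHom.onTheory_model _ T).2 hM) ((Theory.model_iff _).2 ?_)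
      rintro _ ⟨t, ht, s, rfl⟩
      refine (Formula.realize_equivSentence M (τ t s)).2 ?_
      rw [realize_signedFormula, Formula.realize_relabel]
      refine _root_.Iff.trans (iff_of_eq (congrArg _ (funext ?_)))
        (hb (fun i => decide ((i : ℕ) ∈ s)) ⟨t, ht⟩)
      rintro (i | i)
      · change c (Sum.inl (t, i)) = _
        simp [c, ht]
      · rfl
    exact Theory.Model.isSatisfiable M
  obtain ⟨N⟩ := hsat
  have hN (n : ℕ) : N ⊨ S n := Theory.Model.mono N.is_model (subset_iUnion S n)
  let _ : L.Structure N := (L.lhomWithConstants C).reduct N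
  have : (L.lhomWithConstants C).IsExpansionOn N := LHom.isExpansionOn_reduct _ _
  have hT : N ⊨ T :=
    (LHom.onTheory_model (L.lhomWithConstants C) T).1 (Theory.Model.mono (hN 0) subset_union_left)
  refine hφ (Theory.ModelType.of T N) ⟨fun t i => (L.con (Sum.inl (t, i) : C) : N),
    fun s i => (L.con (Sum.inr (s, i) : C) : N), fun t s => ?_⟩
  have h1 := (Formula.realize_equivSentence N (τ t s)).1
    ((hN (t + 1)).realize_of_mem _ (Or.inr ⟨t, t.lt_succ_self, s, rfl⟩))
  rw [realize_signedFormula, Formula.realize_relabel, decide_eq_true_iff] at h1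
  refine _root_.Iff.trans (iff_of_eq (congrArg _ (funext ?_))) h1
  rintro (i | i) <;> rfl

/-- If `T` is NIP and all types in at most `n` variables over a model `M` are definable, then all
externally definable subsets of `M ^ k`, `k ≤ n`, are definable. -/
theorem Theory.IsNIP.isStablyEmbeddedModel {T : L.Theory} (hT : T.IsNIP) [Nonempty M] (hM : M ⊨ T) {n : ℕ}
    (h : L.IsStablyEmbeddedModel M ⊤ (n : ℕ∞)) :
    L.IsStablyEmbeddedModel M (n : ℕ∞) ⊤ := by
  intro N _ f k l hk _ φ a
  have hk : k ≤ n := by exact_mod_cast hk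
  let X : Set (Fin k → M) := {x | φ.Realize (Sum.elim (f ∘ x) a)}
  by_cases hX : (univ : Set M).Definable L X
  · obtain ⟨j, ψ, b, hψ⟩ := definable_univ_iff_exists_tuple.1 hX
    refine ⟨j, ψ, f ∘ b, fun i => ⟨_, rfl⟩, fun x hx => ?_⟩
    choose y hy using hx
    obtain rfl : f ∘ y = x := funext hy
    rw [← Sum.comp_elim, f.map_formula]
    exact Set.ext_iff.1 hψ y
  · exfalso
    obtain ⟨U, hUX, hU⟩ := exists_ultrafilter_pair_of_not_definable hX
    refine (hT k l φ).not_forall_exists_shattered hM fun m => ?_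
    have key (ε : Fin m → Bool) :
        ∀ᶠ x in mixedPower U m fun _ => true, Function.uncurry x ∈
          {v : Fin m × Fin k → M | (patternFormula φ ε).Realize v} := by
      refine h.eventually_mixedPower_of_definable hk hU m
        (definable_univ_iff_exists_tuple.2 ⟨0, (patternFormula φ ε).relabel Sum.inl,
          Fin.elim0, ?_⟩) ε _ ?_
      · ext v
        simp only [mem_ofPred_eq, Formula.realize_relabel, Sum.elim_comp_inl]
      · filter_upwards [eventually_mixedPower_forall U _ hUX m ε] with x hx
        -- `patternFormula φ ε` quantifies `y` away, so it descends from `N`, where `a` is a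
        -- witness, to `M`.
        refine (f.map_formula _ _).1 ?_
        exact (realize_patternFormula φ ε fun i => f ∘ x i).2 ⟨a, hx⟩
    -- There are only finitely many patterns `ε`, so one `x` serves them all.
    obtain ⟨x, hx⟩ := (eventually_all.2 key).exists
    exact ⟨x, fun ε => (realize_patternFormula φ ε x).1 (hx ε)⟩

end FirstOrder.Language

theorem mainTheorem12 {L : FirstOrder.Language.{u, v}} (T : L.Theory) (hT : T.IsNIP)
    (M : Type w) [L.Structure M] [Nonempty M] (hM : M ⊨ T) (n : ℕ)
    (h : L.IsStablyEmbeddedModel M ⊤ (n : ℕ∞)) :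
    L.IsStablyEmbeddedModel M (n : ℕ∞) ⊤ :=
  hT.isStablyEmbeddedModel hM h
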